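/- **Theorem 4.1.** Let $a\ge 1$, and let $\phi,\psi\in L^2(\mathbb R)$ both have (essential) support equal to $[0,a]$. Assume that $(V_j)_{j\in\mathbb Z}$ is a multiresolution analysis of $L^2(\mathbb R)$ with orthonormal scaling function $\phi$: the $V_j$ are closed subspaces, $V_j\subset V_{j+1}$, $f\in V_j$ if and only if $f(2\cdot)\in V_{j+1}$, $\bigcap_j V_j=\{0\}$, $\overline{\bigcup_j V_j}=L^2(\mathbb R)$, and $\{\phi(\cdot-k)\}_{k\in\mathbb Z}$ is an orthonormal basis of $V_0$. Assume that $\psi$ is an associated orthonormal wavelet: $\{\psi(\cdot-k)\}_{k\in\mathbb Z}$ is an orthonormal basis of the orthogonal complement of $V_0$ in $V_1$. Write $f_{j,k}=2^{j/2}f(2^j\cdot-k)$. Let $(\varphi_m)_{m\ge1}$ be the sequence that lists first $\phi_{0,k}$ for $k=-\lceil a\rceil+1,\dots,\lceil a\rceil-1$, and then, for $j=0,1,2,\dots$ in turn, $\psi_{j,k}$ for $k=-\lceil a\rceil+1,\dots,2^j\lceil a\rceil-1$. Let $\mathcal T_N=\mathrm{span}\{\varphi_1,\dots,\varphi_N\}$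 and $N_R=2^R\lceil a\rceil+(R+1)(\lceil a\rceil-1)$ for $R=0,1,2,\dots$. For reals $T_1\ge\lceil a\rceil-1$, $T_2\ge 2\lceil a\rceil-1$ and $0<\epsilon\le 1/(T_1+T_2)$, let $$s_l^\epsilon(x)=\sqrt\epsilon\,e^{2\pi i l\epsilon x}\,\chi_{\left[-\frac{T_1}{\epsilon(T_1+T_2)},\,\frac{T_2}{\epsilon(T_1+T_2)}\right]}(x)\quad(l\in\mathbb Z),$$ $$\mathcal S_M^\epsilon=\mathrm{span}\{s_l^\epsilon:-\lfloor M/2\rfloor\le l\le\lceil M/2\rceil-1\},$$ let $P_M$ be the orthogonal projection of $L^2(\mathbb R)$ onto $\mathcal S_M^\epsilon$, and let $$C_{N,M}=\Bigl(\inf_{f\in\mathcal T_N,\ \|f\|=1}\langle P_Mf,f\rangle\Bigr)^{1/2},\qquad \Theta(N;\theta)=\min\{M\in\mathbb N:\ 1/C_{N,M}<\theta\},$$ with $1/0=\infty$ and $\min\emptyset=\infty$. Then for every $\theta\in(1,\infty)$ there is a positive integer $S_\theta$, depending only on $\phi,\psi,a,\theta$ (in particular not on $R$, $N$, $\epsilon$,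 $T_1$, $T_2$), such that for all such $T_1,T_2,\epsilon$: 1. for all integers $R\ge0$ and $1\le N\le N_R$, with $M=\lceil S_\theta 2^{R+1}/\epsilon\rceil$ one has $C_{N,M}\ge 1/\theta$; 2. for all integers $N\ge1$, $\displaystyle \Theta(N;\theta)\le\left\lceil\frac{2S_\theta N}{\epsilon\lceil a\rceil}\right\rceil$; hence $\Theta(N;\theta)=\mathcal O(N)$ as $N\to\infty$. -/

import Mathlib

open MeasureTheory Set Filter Topology

/-- The Hilbert space `L²(ℝ)` of complex-valued square-integrable functions. -/
abbrev L2R : Type := Lp ℂ 2 (volume : Measure ℝ)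

theorem memLp_affine (s : ℝ) (hs : s ≠ 0) (b : ℝ) (f : L2R) :
    MemLp (fun x : ℝ => f (s * x - b)) 2 volume := by
  have h1 : MemLp (fun x : ℝ => f (x - b)) 2 volume :=
    (Lp.memLp f).comp_measurePreserving (measurePreserving_sub_right volume b)
  have h2 : MemLp (fun x : ℝ => f (x - b)) 2 (Measure.map (fun x : ℝ => s * x) volume) := by
    rw [Real.map_volume_mul_left hs]
    exact h1.smul_measure ENNReal.ofReal_ne_top
  exact h2.comp_of_map (measurable_const_mul s).aemeasurable

/-- The function `x ↦ f (s x - b)`, as an element of `L²(ℝ)`. -/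
noncomputable def affineComp (s : ℝ) (hs : s ≠ 0) (b : ℝ) (f : L2R) : L2R :=
  (memLp_affine s hs b f).toLp (fun x : ℝ => f (s * x - b))

/-- `f_{j,k} = 2^{j/2} f (2^j · - k)`, as an element of `L²(ℝ)`. -/
noncomputable def dyadic (f : L2R) (j k : ℤ) : L2R :=
  (((2 : ℝ) ^ ((j : ℝ) / 2) : ℝ) : ℂ) •
    affineComp ((2 : ℝ) ^ j) (zpow_ne_zero j two_ne_zero) (k : ℝ) f

/-- The support of an element of `L²(ℝ)`: the complement of the largest open set on which it
vanishes almost everywhere. -/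
def essSupport (f : L2R) : Set ℝ :=
  {x | ∀ U ∈ 𝓝 x, ¬ ∀ᵐ y ∂(volume : Measure ℝ), y ∈ U → f y = 0}

/-- `(V_j)` is a multiresolution analysis of `L²(ℝ)` with orthonormal scaling function `φ`. -/
structure IsMRA (V : ℤ → Submodule ℂ L2R) (φ : L2R) : Prop where
  isClosed : ∀ j, IsClosed (V j : Set L2R)
  nested : ∀ j, V j ≤ V (j + 1)
  dilation : ∀ j (f : L2R), f ∈ V j ↔ affineComp 2 two_ne_zero 0 f ∈ V (j + 1)
  inter : ⋂ j, (V j : Set L2R) = {0}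
  dense : closure (⋃ j, (V j : Set L2R)) = univ
  orthonormal : Orthonormal ℂ (fun k : ℤ => dyadic φ 0 k)
  basis : (Submodule.span ℂ (range fun k : ℤ => dyadic φ 0 k)).topologicalClosure = V 0

/-- `ψ` is an orthonormal wavelet associated with the multiresolution analysis `(V_j)`: its
integer translates form an orthonormal basis of the orthogonal complement of `V_0` in `V_1`. -/
structure IsMRAWavelet (V : ℤ → Submodule ℂ L2R) (ψ : L2R) : Prop where
  orthonormal : Orthonormal ℂ (fun k : ℤ => dyadic ψ 0 k)
  basis : (Submodule.span ℂ (range fun k : ℤ => dyadic ψ 0 k)).topologicalClosure =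
    (V 0)ᗮ ⊓ V 1

/-- `N_R = 2^R n + (R + 1)(n - 1)`, where `n = ⌈a⌉`. -/
def levelDim (n R : ℕ) : ℕ := 2 ^ R * n + (R + 1) * (n - 1)

/-- The scale of the reconstruction vector number `m` (counted from `0`), when `m ≥ N_0`: the
largest `j` with `N_j ≤ m`. -/
def scaleOf (n m : ℕ) : ℕ := Nat.findGreatest (fun j => levelDim n j ≤ m) m

/-- The reconstruction vectors, numbered from `0`, with `n = ⌈a⌉`: first the `2n - 1 = N_0`
scaling functions `φ_{0,k}`, `-n+1 ≤ k ≤ n-1`, then for `j = 0, 1, 2, …` in turn the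
wavelets `ψ_{j,k}`, `-n+1 ≤ k ≤ 2^j n - 1`, in increasing order of `k`; the first wavelet of
scale `j` has number `N_j`. -/
noncomputable def reconVec (φ ψ : L2R) (n m : ℕ) : L2R :=
  if m < levelDim n 0 then dyadic φ 0 ((m : ℤ) - n + 1)
  else dyadic ψ (scaleOf n m) ((m : ℤ) - levelDim n (scaleOf n m) - n + 1)

/-- The reconstruction space `T_N`, the span of the first `N` reconstruction vectors. -/
noncomputable def reconSpace (φ ψ : L2R) (n N : ℕ) : Submodule ℂ L2R :=
  Submodule.span ℂ (reconVec φ ψ n '' {m | m < N})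

/-- The function `√ε e^{2π i l ε x}`, cut off to
`[-T₁ / (ε (T₁ + T₂)), T₂ / (ε (T₁ + T₂))]`. -/
noncomputable def sampleFun (T₁ T₂ ε : ℝ) (l : ℤ) : ℝ → ℂ :=
  (Icc (-T₁ / (ε * (T₁ + T₂))) (T₂ / (ε * (T₁ + T₂)))).indicator
    fun x => (Real.sqrt ε : ℂ) * Complex.exp (2 * Real.pi * Complex.I * l * ε * x)

theorem memLp_sampleFun (T₁ T₂ ε : ℝ) (l : ℤ) : MemLp (sampleFun T₁ T₂ ε l) 2 volume := by
  unfold sampleFun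
  rw [memLp_indicator_iff_restrict measurableSet_Icc]
  have hc : Continuous fun x : ℝ =>
      (Real.sqrt ε : ℂ) * Complex.exp (2 * Real.pi * Complex.I * l * ε * x) := by fun_prop
  obtain ⟨C, hC⟩ := (isCompact_Icc (a := -T₁ / (ε * (T₁ + T₂)))
    (b := T₂ / (ε * (T₁ + T₂)))).exists_bound_of_continuousOn hc.continuousOn
  exact MemLp.of_bound hc.aestronglyMeasurable C
    ((ae_restrict_mem measurableSet_Icc).mono hC)

/-- The sampling vector `s_l^ε`. -/
noncomputable def sampleVec (T₁ T₂ ε : ℝ) (l : ℤ) : L2R :=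
  (memLp_sampleFun T₁ T₂ ε l).toLp (sampleFun T₁ T₂ ε l)

/-- The sampling space `S_M^ε`, the span of the `s_l^ε` with `-⌊M/2⌋ ≤ l ≤ ⌈M/2⌉ - 1`. -/
noncomputable def sampleSpace (T₁ T₂ ε : ℝ) (M : ℕ) : Submodule ℂ L2R :=
  Submodule.span ℂ (sampleVec T₁ T₂ ε '' Icc (-⌊(M : ℝ) / 2⌋) (⌈(M : ℝ) / 2⌉ - 1))

noncomputable instance sampleSpace_finiteDimensional (T₁ T₂ ε : ℝ) (M : ℕ) :
    FiniteDimensional ℂ (sampleSpace T₁ T₂ ε M) :=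
  FiniteDimensional.span_of_finite ℂ ((finite_Icc _ _).image _)

/-- The subspace angle
`C_{N,M} = (inf {⟨P_M f, f⟩ : f ∈ T_N, ‖f‖ = 1})^{1/2}` between `T_N` and `S_M^ε`, where `P_M`
is the orthogonal projection onto `S_M^ε` (the inner products are real). -/
noncomputable def subspaceAngle (φ ψ : L2R) (n : ℕ) (T₁ T₂ ε : ℝ) (N M : ℕ) : ℝ :=
  Real.sqrt (sInf ((fun f : L2R =>
    (inner ℂ ((sampleSpace T₁ T₂ ε M).starProjection f) f).re) ''
      {f | f ∈ reconSpace φ ψ n N ∧ ‖f‖ = 1}))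

/-- The stable sampling rate `Θ(N; θ) = min {M : 1 / C_{N,M} < θ}`, where `1 / 0 = ∞`. It takes
the value `⊤` if there is no such `M`. -/
noncomputable def stableSamplingRate (φ ψ : L2R) (n : ℕ) (T₁ T₂ ε : ℝ) (N : ℕ) (θ : ℝ) : ℕ∞ :=
  ⨅ M ∈ {M : ℕ | 0 < subspaceAngle φ ψ n T₁ T₂ ε N M ∧
    1 / subspaceAngle φ ψ n T₁ T₂ ε N M < θ}, (M : ℕ∞)

/-! Write n = ⌈a⌉. For N ≤ N_R the space T_N lies in V_R and its elements live on [-(n-1), 2n-1]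
(`reconSpace_le`), an interval inside the sampling interval. The sampling vectors are an orthonormal
Fourier basis of L² of that larger interval, so everything reduces to a Fourier tail estimate of the
form ‖f - P_M f‖ ≤ η‖f‖ (`IsMRA.exists_sampling_constant`).

Since φ is only in L², expand f = Σ α_k φ_{R,k} and replace φ by a C¹ function w close to it,
supported in [0, n] and zero at every integer (`exists_smooth_approx`). Bounded overlap of the
translates keeps the error below (η/2)‖f‖, uniformly in R. The new sum vanishes at integers, so it
can be cut off at the integer endpoints without losing integration by parts. Its derivative has norm
O(2^R ‖f‖), hence the frequencies beyond S·2^R contribute at most (η/2)‖f‖ once S is large, with S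
depending only on n, η, w.

By Pythagoras C_{N,M}² ≥ 1 - η². The linear rate follows because the least R with N ≤ N_R satisfies
2^R ≤ 2N. -/

theorem L2R.norm_sq_eq_integral (f : L2R) : ‖f‖ ^ 2 = ∫ x, ‖f x‖ ^ 2 := by
  have h := congr_arg Complex.re (L2.inner_def (𝕜 := ℂ) f f)
  simp only [inner_self_eq_norm_sq_to_K] at h
  have h2 : (∫ x, ((‖f x‖ : ℝ) : ℂ) ^ 2) = ((∫ x, ‖f x‖ ^ 2 : ℝ) : ℂ) := by
    rw [← integral_complex_ofReal]
    push_cast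
    rfl
  erw [h2] at h
  simpa [← Complex.ofReal_pow] using h

/-- The elements of `L²(ℝ)` that vanish almost everywhere off `s`. -/
def supportedIn (s : Set ℝ) : Submodule ℂ L2R where
  carrier := {f | ∀ᵐ x, x ∉ s → f x = 0}
  zero_mem' := by
    filter_upwards [Lp.coeFn_zero ℂ 2 (volume : Measure ℝ)] with x hx _
    rw [hx]; rfl
  add_mem' := by
    intro f g hf hg
    filter_upwards [hf, hg, Lp.coeFn_add f g] with x h1 h2 h3 hx
    rw [h3, Pi.add_apply, h1 hx, h2 hx, add_zero]
  smul_mem' := by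
    intro c f hf
    filter_upwards [hf, Lp.coeFn_smul c f] with x h1 h3 hx
    rw [h3, Pi.smul_apply, h1 hx, smul_zero]

theorem mem_supportedIn {s : Set ℝ} {f : L2R} :
    f ∈ supportedIn s ↔ ∀ᵐ x, x ∉ s → f x = 0 := Iff.rfl

theorem supportedIn_mono {s t : Set ℝ} (h : s ⊆ t) : supportedIn s ≤ supportedIn t :=
  fun _ hf => (mem_supportedIn.1 hf).mono fun _ hx hxt => hx fun hs => hxt (h hs)

/-! ### Fourier analysis on the sampling interval -/

/-- The interval on which the sampling vectors live. -/
abbrev sampleInterval (T₁ T₂ ε : ℝ) : Set ℝ :=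
  Icc (-T₁ / (ε * (T₁ + T₂))) (T₂ / (ε * (T₁ + T₂)))

theorem inner_sampleVec (T₁ T₂ ε : ℝ) (l : ℤ) (h : L2R) :
    inner ℂ (sampleVec T₁ T₂ ε l) h =
      ∫ x in Icc (-T₁ / (ε * (T₁ + T₂))) (T₂ / (ε * (T₁ + T₂))),
        (Real.sqrt ε : ℂ) * Complex.exp (-(2 * Real.pi * Complex.I * l * ε * x)) * h x := by
  rw [L2.inner_def, ← integral_indicator measurableSet_Icc]
  apply integral_congr_ae
  filter_upwards [(memLp_sampleFun T₁ T₂ ε l).coeFn_toLp] with x hx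
  rw [sampleVec, hx, RCLike.inner_apply, sampleFun]
  by_cases hI : x ∈ Icc (-T₁ / (ε * (T₁ + T₂))) (T₂ / (ε * (T₁ + T₂)))
  · simp only [indicator_of_mem hI, map_mul, ← Complex.exp_conj, Complex.conj_ofReal,
      Complex.conj_I, Complex.conj_ofNat, map_intCast]
    rw [show (2 * (Real.pi : ℂ) * -Complex.I * l * ε * x)
      = -(2 * Real.pi * Complex.I * l * ε * x) by ring]
    ring
  · simp [indicator_of_notMem hI]

theorem sampleInterval_length {T₁ T₂ ε : ℝ} (hT : 0 < T₁ + T₂) (hε : 0 < ε) :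
    T₂ / (ε * (T₁ + T₂)) - -T₁ / (ε * (T₁ + T₂)) = ε⁻¹ := by
  field_simp
  ring

theorem sampleInterval_lt {T₁ T₂ ε : ℝ} (hT : 0 < T₁ + T₂) (hε : 0 < ε)
    : -T₁ / (ε * (T₁ + T₂)) < T₂ / (ε * (T₁ + T₂)) := by
  have := sampleInterval_length hT hε
  have := inv_pos.2 hε
  linarith

theorem inner_sampleVec_eq_fourierCoeffOn {T₁ T₂ ε : ℝ} (hT : 0 < T₁ + T₂) (hε : 0 < ε)
    (l : ℤ) (h : L2R) :
    inner ℂ (sampleVec T₁ T₂ ε l) h =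
      ((Real.sqrt ε)⁻¹ : ℂ) * fourierCoeffOn (sampleInterval_lt hT hε) h l := by
  rw [inner_sampleVec, fourierCoeffOn_eq_integral, sampleInterval_length hT hε,
    intervalIntegral.integral_of_le (sampleInterval_lt hT hε).le, integral_Icc_eq_integral_Ioc,
    Complex.real_smul, ← mul_assoc, ← integral_const_mul]
  apply integral_congr_ae
  refine ae_of_all _ fun x => ?_
  have hs : (Real.sqrt ε : ℂ) * Real.sqrt ε = ε := by
    rw [← Complex.ofReal_mul, Real.mul_self_sqrt hε.le]
  have hs0 : (Real.sqrt ε : ℂ) ≠ 0 := by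
    exact_mod_cast (Real.sqrt_pos.2 hε).ne'
  have hε0 : (ε : ℂ) ≠ 0 := by exact_mod_cast hε.ne'
  simp only [fourier_coe_apply, smul_eq_mul, one_div, inv_inv]
  rw [show (2 * (Real.pi : ℂ) * Complex.I * ((-l : ℤ) : ℂ) * x / ((ε⁻¹ : ℝ) : ℂ))
      = -(2 * Real.pi * Complex.I * l * ε * x) by push_cast; field_simp, ← mul_assoc]
  congr 2
  rw [← hs]
  field_simp

/-- Parseval on an interval of length 1/ε; the factor √ε is the normalisation, and the support
condition turns the integral over the interval into the full norm. -/
theorem hasSum_sq_inner_sampleVec {T₁ T₂ ε : ℝ} (hT : 0 < T₁ + T₂) (hε : 0 < ε) (h : L2R)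
    (hh : h ∈ supportedIn (sampleInterval T₁ T₂ ε)) :
    HasSum (fun l : ℤ => ‖inner ℂ (sampleVec T₁ T₂ ε l) h‖ ^ 2) (‖h‖ ^ 2) := by
  have key := (hasSum_sq_fourierCoeffOn (sampleInterval_lt hT hε)
    ((Lp.memLp h).restrict _)).mul_left ε⁻¹
  have e1 : (fun l : ℤ => ‖inner ℂ (sampleVec T₁ T₂ ε l) h‖ ^ 2) = fun l =>
      ε⁻¹ * ‖fourierCoeffOn (sampleInterval_lt hT hε) h l‖ ^ 2 := by
    funext l
    rw [inner_sampleVec_eq_fourierCoeffOn hT hε, norm_mul, mul_pow, norm_inv, Complex.norm_real,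
      Real.norm_of_nonneg (Real.sqrt_nonneg _), inv_pow, Real.sq_sqrt hε.le]
  have e2 : ‖h‖ ^ 2 = ε⁻¹ * ((T₂ / (ε * (T₁ + T₂)) - -T₁ / (ε * (T₁ + T₂)))⁻¹ •
      ∫ x in (-T₁ / (ε * (T₁ + T₂)))..(T₂ / (ε * (T₁ + T₂))), ‖h x‖ ^ 2) := by
    rw [sampleInterval_length hT hε, inv_inv, smul_eq_mul, ← mul_assoc, inv_mul_cancel₀ hε.ne',
      one_mul, L2R.norm_sq_eq_integral, intervalIntegral.integral_of_le (sampleInterval_lt hT hε).le,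
      ← integral_Icc_eq_integral_Ioc, ← integral_indicator measurableSet_Icc]
    apply integral_congr_ae
    filter_upwards [hh] with x hx
    by_cases hI : x ∈ Icc (-T₁ / (ε * (T₁ + T₂))) (T₂ / (ε * (T₁ + T₂)))
    · rw [indicator_of_mem hI]
    · rw [indicator_of_notMem hI, hx hI]; simp
  rw [e1, e2]
  exact key

theorem sampleVec_mem_supportedIn (T₁ T₂ ε : ℝ) (l : ℤ) :
    sampleVec T₁ T₂ ε l ∈ supportedIn (sampleInterval T₁ T₂ ε) := by
  rw [mem_supportedIn]
  filter_upwards [(memLp_sampleFun T₁ T₂ ε l).coeFn_toLp] with x hx hI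
  rw [sampleVec, hx, sampleFun, indicator_of_notMem hI]

theorem norm_sampleVec {T₁ T₂ ε : ℝ} (hT : 0 < T₁ + T₂) (hε : 0 < ε)
    (l : ℤ) : ‖sampleVec T₁ T₂ ε l‖ = 1 := by
  have : ‖sampleVec T₁ T₂ ε l‖ ^ 2 = 1 := by
    rw [L2R.norm_sq_eq_integral]
    have : (fun x => ‖sampleVec T₁ T₂ ε l x‖ ^ 2) =ᵐ[volume]
        (Icc (-T₁ / (ε * (T₁ + T₂))) (T₂ / (ε * (T₁ + T₂)))).indicator fun _ => ε := by
      filter_upwards [(memLp_sampleFun T₁ T₂ ε l).coeFn_toLp] with x hx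
      rw [sampleVec, hx, sampleFun]
      by_cases hI : x ∈ Icc (-T₁ / (ε * (T₁ + T₂))) (T₂ / (ε * (T₁ + T₂)))
      · rw [indicator_of_mem hI, indicator_of_mem hI, norm_mul,
          show 2 * (Real.pi : ℂ) * Complex.I * l * ε * x
            = ((2 * Real.pi * l * ε * x : ℝ) : ℂ) * Complex.I by push_cast; ring,
          Complex.norm_exp_ofReal_mul_I, Complex.norm_real,
          Real.norm_of_nonneg (Real.sqrt_nonneg _), mul_one, Real.sq_sqrt hε.le]
      · simp [indicator_of_notMem hI]
    rw [integral_congr_ae this, integral_indicator measurableSet_Icc, setIntegral_const,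
      Real.volume_real_Icc, sampleInterval_length hT hε, max_eq_left (inv_pos.2 hε).le,
      smul_eq_mul, inv_mul_cancel₀ hε.ne']
  nlinarith [norm_nonneg (sampleVec T₁ T₂ ε l)]

/-- Orthogonality comes from Parseval applied to s_m: the term l = m already exhausts the total 1,
so all others vanish. -/
theorem orthonormal_sampleVec {T₁ T₂ ε : ℝ} (hT : 0 < T₁ + T₂) (hε : 0 < ε)
    : Orthonormal ℂ (sampleVec T₁ T₂ ε) := by
  refine ⟨norm_sampleVec hT hε, fun l m hlm => ?_⟩
  have h := hasSum_sq_inner_sampleVec hT hε (sampleVec T₁ T₂ ε m)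
    (sampleVec_mem_supportedIn T₁ T₂ ε m)
  have h2 := sum_le_hasSum {l, m} (fun _ _ => sq_nonneg _) h
  rw [Finset.sum_pair hlm, inner_self_eq_norm_sq_to_K, norm_sampleVec hT hε] at h2
  have : ‖inner ℂ (sampleVec T₁ T₂ ε l) (sampleVec T₁ T₂ ε m)‖ ^ 2 ≤ 0 := by
    simpa using h2
  exact norm_eq_zero.1 (pow_eq_zero_iff two_ne_zero |>.1 (le_antisymm this (sq_nonneg _)))

/-- A function whose sampling coefficients are dominated by those of its "derivative" `h'`
divided by the frequency is well approximated from the sampling space. -/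
theorem norm_sub_starProjection_sampleSpace_le {T₁ T₂ ε : ℝ} (hT : 0 < T₁ + T₂) (hε : 0 < ε) (h h' : L2R)
    (hh : h ∈ supportedIn (sampleInterval T₁ T₂ ε))
    (hh' : h' ∈ supportedIn (sampleInterval T₁ T₂ ε))
    (hd : ∀ l : ℤ, |(l : ℝ)| * ε * ‖inner ℂ (sampleVec T₁ T₂ ε l) h‖
      ≤ ‖inner ℂ (sampleVec T₁ T₂ ε l) h'‖)
    {M : ℕ} {K : ℝ} (hK : 0 < K) (hM : 2 * K ≤ M * ε) :
    ‖h - (sampleSpace T₁ T₂ ε M).starProjection h‖ ≤ ‖h'‖ / K := by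
  set W := Finset.Icc (-⌊(M : ℝ) / 2⌋) (⌈(M : ℝ) / 2⌉ - 1) with hW
  set q : L2R := ∑ l ∈ W, inner ℂ (sampleVec T₁ T₂ ε l) h • sampleVec T₁ T₂ ε l with hq
  have ho := orthonormal_sampleVec hT hε
  have hqmem : q ∈ sampleSpace T₁ T₂ ε M := by
    refine Submodule.sum_mem _ fun l hl => Submodule.smul_mem _ _ (Submodule.subset_span ?_)
    exact ⟨l, by simpa [hW] using hl, rfl⟩
  have h1 : ‖h - (sampleSpace T₁ T₂ ε M).starProjection h‖ ≤ ‖h - q‖ := by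
    rw [Submodule.starProjection_minimal]
    exact ciInf_le ⟨0, by rintro _ ⟨y, rfl⟩; exact norm_nonneg _⟩
      (⟨q, hqmem⟩ : sampleSpace T₁ T₂ ε M)
  refine h1.trans ?_
  have hqsupp : h - q ∈ supportedIn (sampleInterval T₁ T₂ ε) :=
    Submodule.sub_mem _ hh (Submodule.sum_mem _ fun l _ => Submodule.smul_mem _ _
      (sampleVec_mem_supportedIn T₁ T₂ ε l))
  have hs := hasSum_sq_inner_sampleVec hT hε (h - q) hqsupp
  have hs' := (hasSum_sq_inner_sampleVec hT hε h' hh').mul_left (1 / K ^ 2)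
  -- Parseval on both sides reduces the bound to single coefficients: those of h - q vanish inside
  -- the window W, and outside it |l|ε ≥ K.
  have hle := hasSum_le (fun l => ?_) hs hs'
  · rw [div_mul_eq_mul_div, one_mul, ← div_pow] at hle
    exact (pow_le_pow_iff_left₀ (norm_nonneg _) (by positivity) two_ne_zero).1 hle
  rw [inner_sub_right, hq]
  by_cases hl : l ∈ W
  · rw [ho.inner_right_sum _ hl, sub_self]
    rw [norm_zero, zero_pow two_ne_zero]
    exact mul_nonneg (by positivity) (sq_nonneg _)
  · have : inner ℂ (sampleVec T₁ T₂ ε l)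
        (∑ l ∈ W, inner ℂ (sampleVec T₁ T₂ ε l) h • sampleVec T₁ T₂ ε l) = 0 := by
      rw [inner_sum]
      refine Finset.sum_eq_zero fun m hm => ?_
      rw [inner_smul_right, ho.inner_eq_zero (fun e => hl (by rwa [e])), mul_zero]
    rw [this, sub_zero]
    -- The window is asymmetric for odd M, but both first missing frequencies, -⌊M/2⌋ - 1 and ⌈M/2⌉,
    -- have modulus at least M/2.
    have hl2 : (M : ℝ) / 2 ≤ |(l : ℝ)| := by
      rw [hW, Finset.mem_Icc, not_and_or, not_le, not_le] at hl
      rcases hl with hl | hl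
      · have h1 : l + 1 ≤ -⌊(M : ℝ) / 2⌋ := hl
        have h2 : (l : ℝ) + 1 ≤ -(⌊(M : ℝ) / 2⌋ : ℝ) := by exact_mod_cast h1
        have := Int.lt_floor_add_one ((M : ℝ) / 2)
        linarith [neg_abs_le (l : ℝ)]
      · have h1 : ⌈(M : ℝ) / 2⌉ ≤ l := by omega
        exact (Int.ceil_le.1 h1).trans (le_abs_self _)
    have hKl : K ≤ |(l : ℝ)| * ε := by nlinarith
    have := (mul_le_mul_of_nonneg_right hKl (norm_nonneg _)).trans (hd l)
    rw [div_mul_eq_mul_div, one_mul, le_div_iff₀ (by positivity), mul_comm, ← mul_pow]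
    exact pow_le_pow_left₀ (by positivity) this 2

/-! ### Dyadic dilations and translations -/

theorem quasiMeasurePreserving_affine (s : ℝ) (hs : s ≠ 0) (b : ℝ) :
    Measure.QuasiMeasurePreserving (fun x : ℝ => s * x - b) volume volume := by
  refine (measurePreserving_sub_right volume b).quasiMeasurePreserving.comp
    ⟨measurable_const_mul s, ?_⟩
  rw [Real.map_volume_mul_left hs]
  exact Measure.smul_absolutelyContinuous

theorem coeFn_affineComp (s : ℝ) (hs : s ≠ 0) (b : ℝ) (f : L2R) :
    affineComp s hs b f =ᵐ[volume] fun x => f (s * x - b) :=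
  MemLp.coeFn_toLp _

theorem coeFn_dyadic (f : L2R) (j k : ℤ) :
    dyadic f j k =ᵐ[volume] fun x => (((2 : ℝ) ^ ((j : ℝ) / 2) : ℝ) : ℂ) * f (2 ^ j * x - k) := by
  filter_upwards [Lp.coeFn_smul (((2 : ℝ) ^ ((j : ℝ) / 2) : ℝ) : ℂ)
    (affineComp ((2 : ℝ) ^ j) (zpow_ne_zero j two_ne_zero) (k : ℝ) f),
    coeFn_affineComp ((2 : ℝ) ^ j) (zpow_ne_zero j two_ne_zero) (k : ℝ) f] with x h1 h2
  rw [dyadic, h1, Pi.smul_apply, h2, smul_eq_mul]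

theorem affineComp_affineComp (s t : ℝ) (hs : s ≠ 0) (ht : t ≠ 0) (f : L2R) :
    affineComp s hs 0 (affineComp t ht 0 f) = affineComp (t * s) (mul_ne_zero ht hs) 0 f := by
  apply Lp.ext
  filter_upwards [coeFn_affineComp s hs 0 (affineComp t ht 0 f),
    coeFn_affineComp (t * s) (mul_ne_zero ht hs) 0 f,
    (quasiMeasurePreserving_affine s hs 0).ae (coeFn_affineComp t ht 0 f)] with x h1 h2 h3
  rw [h1, h2, h3]
  congr 1
  ring

theorem affineComp_two_half (f : L2R) :
    affineComp 2 two_ne_zero 0 (affineComp 2⁻¹ (inv_ne_zero two_ne_zero) 0 f) = f := by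
  rw [affineComp_affineComp]
  apply Lp.ext
  filter_upwards [coeFn_affineComp (2⁻¹ * 2 : ℝ)
    (mul_ne_zero (inv_ne_zero two_ne_zero) two_ne_zero) 0 f] with x h1
  rw [h1]
  norm_num

theorem affineComp_zero (s : ℝ) (hs : s ≠ 0) (b : ℝ) : affineComp s hs b 0 = 0 := by
  apply Lp.ext
  filter_upwards [coeFn_affineComp s hs b 0, Lp.coeFn_zero ℂ 2 (volume : Measure ℝ),
    (quasiMeasurePreserving_affine s hs b).ae (Lp.coeFn_zero ℂ 2 (volume : Measure ℝ))]
    with x h1 h2 h3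
  rw [h1, h2, h3]; rfl

theorem inner_affineComp (s : ℝ) (hs : 0 < s) (b : ℝ) (f g : L2R) :
    inner ℂ (affineComp s hs.ne' b f) (affineComp s hs.ne' b g) = (s⁻¹ : ℝ) * inner ℂ f g := by
  rw [L2.inner_def, L2.inner_def]
  have : (fun x => inner ℂ (affineComp s hs.ne' b f x) (affineComp s hs.ne' b g x)) =ᵐ[volume]
      fun x => (fun y => inner ℂ (f y) (g y)) (s * x - b) := by
    filter_upwards [coeFn_affineComp s hs.ne' b f, coeFn_affineComp s hs.ne' b g] with x h1 h2
    rw [h1, h2]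
  rw [integral_congr_ae this,
    Measure.integral_comp_mul_left (fun z => (fun y => inner ℂ (f y) (g y)) (z - b)) s,
    integral_sub_right_eq_self (fun y => inner ℂ (f y) (g y)) b, Complex.real_smul,
    abs_of_pos (inv_pos.2 hs)]

theorem norm_affineComp_sq (s : ℝ) (hs : 0 < s) (b : ℝ) (f : L2R) :
    ‖affineComp s hs.ne' b f‖ ^ 2 = s⁻¹ * ‖f‖ ^ 2 := by
  have h := congr_arg Complex.re (inner_affineComp s hs b f f)
  simpa [inner_self_eq_norm_sq_to_K, ← Complex.ofReal_pow] using h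

theorem norm_dyadic (f : L2R) (j k : ℤ) : ‖dyadic f j k‖ = ‖f‖ := by
  have : ‖dyadic f j k‖ ^ 2 = ‖f‖ ^ 2 := by
    rw [dyadic, norm_smul, mul_pow, norm_affineComp_sq _ (by positivity), Complex.norm_real,
      Real.norm_of_nonneg (by positivity), ← Real.rpow_natCast (_ ^ _), ← Real.rpow_mul zero_le_two,
      ← mul_assoc]
    rw [show (j : ℝ) / 2 * (2 : ℕ) = j by push_cast; ring, Real.rpow_intCast,
      mul_inv_cancel₀ (by positivity), one_mul]
  exact (pow_left_inj₀ (norm_nonneg _) (norm_nonneg _) two_ne_zero).1 this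

theorem affineComp_two_dyadic (f : L2R) (j k : ℤ) :
    affineComp 2 two_ne_zero 0 (dyadic f j k)
      = (((2 : ℝ) ^ (-(1 / 2) : ℝ) : ℝ) : ℂ) • dyadic f (j + 1) k := by
  apply Lp.ext
  filter_upwards [coeFn_affineComp 2 two_ne_zero 0 (dyadic f j k),
    Lp.coeFn_smul (((2 : ℝ) ^ (-(1 / 2) : ℝ) : ℝ) : ℂ) (dyadic f (j + 1) k),
    coeFn_dyadic f (j + 1) k,
    (quasiMeasurePreserving_affine 2 two_ne_zero 0).ae (coeFn_dyadic f j k)] with x h1 h2 h3 h4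
  rw [h1, h2, h4, Pi.smul_apply, h3, smul_eq_mul, ← mul_assoc, ← Complex.ofReal_mul,
    ← Real.rpow_add two_pos]
  congr 2
  · congr 2
    push_cast
    ring
  · rw [zpow_add₀ two_ne_zero]
    ring_nf

theorem dyadic_succ (f : L2R) (j k : ℤ) :
    dyadic f (j + 1) k
      = (((2 : ℝ) ^ (1 / 2 : ℝ) : ℝ) : ℂ) • affineComp 2 two_ne_zero 0 (dyadic f j k) := by
  rw [affineComp_two_dyadic, smul_smul, ← Complex.ofReal_mul, ← Real.rpow_add two_pos]
  norm_num

theorem inner_dyadic_succ (f g : L2R) (j k l : ℤ) :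
    inner ℂ (dyadic f (j + 1) k) (dyadic g (j + 1) l) = inner ℂ (dyadic f j k) (dyadic g j l) := by
  rw [dyadic_succ, dyadic_succ, inner_smul_left, inner_smul_right,
    inner_affineComp 2 two_pos, Complex.conj_ofReal, ← mul_assoc, ← mul_assoc,
    ← Complex.ofReal_mul, ← Complex.ofReal_mul, ← Real.rpow_add two_pos]
  norm_num

theorem orthonormal_dyadic {f : L2R} (h : Orthonormal ℂ fun k : ℤ => dyadic f 0 k) (j : ℕ) :
    Orthonormal ℂ fun k : ℤ => dyadic f j k := by
  induction j with
  | zero => exact_mod_cast h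
  | succ j ih =>
    rw [orthonormal_iff_ite] at ih ⊢
    intro k l
    push_cast
    rw [inner_dyadic_succ]
    exact ih k l

theorem dyadic_sub (f g : L2R) (j k : ℤ) :
    dyadic (f - g) j k = dyadic f j k - dyadic g j k := by
  apply Lp.ext
  filter_upwards [coeFn_dyadic (f - g) j k, coeFn_dyadic f j k, coeFn_dyadic g j k,
    Lp.coeFn_sub (dyadic f j k) (dyadic g j k),
    (quasiMeasurePreserving_affine (2 ^ j) (zpow_ne_zero j two_ne_zero) k).ae
      (Lp.coeFn_sub f g)] with x h1 h2 h3 h4 h5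
  rw [h1, h4, Pi.sub_apply, h2, h3, h5, Pi.sub_apply, mul_sub]

theorem dyadic_mem_supportedIn {f : L2R} {s t : Set ℝ} (hf : f ∈ supportedIn s) {j k : ℤ}
    (hst : ∀ x : ℝ, 2 ^ j * x - k ∈ s → x ∈ t) : dyadic f j k ∈ supportedIn t := by
  rw [mem_supportedIn] at *
  filter_upwards [coeFn_dyadic f j k,
    (quasiMeasurePreserving_affine (2 ^ j) (zpow_ne_zero j two_ne_zero) k).ae hf] with x h1 h2 hx
  rw [h1, h2 fun h => hx (hst x h), mul_zero]

/-- Off the support, {f ≠ 0} is locally null, and locally null sets in ℝ are null. -/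
theorem mem_supportedIn_essSupport (f : L2R) : f ∈ supportedIn (essSupport f) := by
  rw [mem_supportedIn, ae_iff]
  refine measure_null_of_locally_null _ fun x hx => ?_
  have hx1 : x ∉ essSupport f := fun h => hx fun h' => absurd h h'
  simp only [essSupport, mem_ofPred_eq, not_forall, not_not] at hx1
  obtain ⟨U, hU, h⟩ := hx1
  refine ⟨_, inter_mem_nhdsWithin _ hU, measure_mono_null ?_ (ae_iff.1 h)⟩
  rintro y ⟨hy, hyU⟩ hy'
  exact hy fun _ => hy' hyU

theorem inner_eq_zero_of_supportedIn {f g : L2R} {s t : Set ℝ} (hf : f ∈ supportedIn s)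
    (hg : g ∈ supportedIn t) (hst : Disjoint s t) : inner ℂ f g = 0 := by
  rw [L2.inner_def]
  apply integral_eq_zero_of_ae
  filter_upwards [mem_supportedIn.1 hf, mem_supportedIn.1 hg] with x h1 h2
  by_cases hx : x ∈ s
  · rw [h2 (disjoint_left.1 hst hx), inner_zero_right]; rfl
  · rw [h1 hx, inner_zero_left]; rfl

/-! ### Expansion in the scaling functions of level j -/

section MRA

variable {V : ℤ → Submodule ℂ L2R} {φ : L2R}

theorem IsMRA.dyadic_mem (hV : IsMRA V φ) {f : L2R} {i k : ℤ} (hf : dyadic f 0 k ∈ V i) (j : ℕ) :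
    dyadic f j k ∈ V (i + j) := by
  induction j with
  | zero => simpa using hf
  | succ j ih =>
    push_cast
    rw [dyadic_succ, ← add_assoc]
    exact Submodule.smul_mem _ _ ((hV.dilation _ _).1 ih)

theorem IsMRA.scaling_mem (hV : IsMRA V φ) (k : ℤ) : dyadic φ 0 k ∈ V 0 := by
  rw [← hV.basis]
  exact Submodule.le_topologicalClosure _ (Submodule.subset_span ⟨k, rfl⟩)

theorem IsMRAWavelet.dyadic_zero_mem {ψ : L2R} (hψ : IsMRAWavelet V ψ) (k : ℤ) :
    dyadic ψ 0 k ∈ V 1 := by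
  have : dyadic ψ 0 k ∈ (V 0)ᗮ ⊓ V 1 := by
    rw [← hψ.basis]
    exact Submodule.le_topologicalClosure _ (Submodule.subset_span ⟨k, rfl⟩)
  exact this.2

theorem IsMRA.le_of_le (hV : IsMRA V φ) {i j : ℤ} (hij : i ≤ j) : V i ≤ V j :=
  monotone_int_of_le_succ hV.nested hij

/-- Totality is assumed only in V_0; dilation by 1/2 carries level j + 1 to level j and preserves
orthogonality. -/
theorem IsMRA.eq_zero_of_inner (hV : IsMRA V φ) (j : ℕ) {f : L2R} (hf : f ∈ V j)
    (h : ∀ k : ℤ, inner ℂ (dyadic φ j k) f = 0) : f = 0 := by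
  induction j generalizing f with
  | zero =>
    have h1 : f ∈ (Submodule.span ℂ (range fun k : ℤ => dyadic φ 0 k)).topologicalClosure := by
      rw [hV.basis]; exact_mod_cast hf
    have h2 : f ∈ (Submodule.span ℂ (range fun k : ℤ => dyadic φ 0 k)).topologicalClosureᗮ := by
      rw [Submodule.orthogonal_closure, Submodule.mem_orthogonal]
      intro u hu
      induction hu using Submodule.span_induction with
      | mem x hx => obtain ⟨k, rfl⟩ := hx; exact_mod_cast h k
      | zero => exact inner_zero_left _
      | add x y _ _ hx hy => rw [inner_add_left, hx, hy, add_zero]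
      | smul c x _ hx => rw [inner_smul_left, hx, mul_zero]
    exact inner_self_eq_zero.1 (h2 f h1)
  | succ j ih =>
    set g := affineComp 2⁻¹ (inv_ne_zero two_ne_zero) 0 f
    have hg : affineComp 2 two_ne_zero 0 g = f := affineComp_two_half f
    have hg0 : g = 0 := by
      refine ih ((hV.dilation _ _).2 ?_) fun k => ?_
      · rw [hg]; exact_mod_cast hf
      · have hk := h k
        push_cast at hk
        rw [← hg, dyadic_succ, inner_smul_left, inner_affineComp 2 two_pos, Complex.conj_ofReal,
          mul_eq_zero, mul_eq_zero] at hk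
        rcases hk with hk | hk | hk
        · exact absurd (Complex.ofReal_eq_zero.1 hk) (by positivity)
        · norm_num at hk
        · exact hk
    rw [← hg, hg0, affineComp_zero]

/-- Elements of `V_j` expand in the translates of the scaling function that meet their support. -/
theorem IsMRA.eq_sum (hV : IsMRA V φ) (j : ℕ) {f : L2R} (hf : f ∈ V j) (F : Finset ℤ)
    (hF : ∀ k ∉ F, inner ℂ (dyadic φ j k) f = 0) :
    f = ∑ k ∈ F, inner ℂ (dyadic φ j k) f • dyadic φ j k := by
  have ho := orthonormal_dyadic hV.orthonormal j
  rw [← sub_eq_zero]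
  refine hV.eq_zero_of_inner j (Submodule.sub_mem _ hf (Submodule.sum_mem _ fun k _ =>
    Submodule.smul_mem _ _ ?_)) fun k => ?_
  · simpa using hV.dyadic_mem (hV.scaling_mem k) j
  · rw [inner_sub_right]
    by_cases hk : k ∈ F
    · rw [ho.inner_right_sum (fun k => inner ℂ (dyadic φ j k) f) hk, sub_self]
    · rw [hF k hk, inner_sum, Finset.sum_eq_zero, sub_zero]
      intro l hl
      rw [inner_smul_right, ho.inner_eq_zero (fun e => hk (by rwa [e])), mul_zero]

end MRA

/-! ### Bounded overlap of translates -/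

theorem card_filter_translates_le (F : Finset ℤ) (y : ℝ) (n : ℕ) :
    (F.filter fun k : ℤ => y - k ∈ Icc (0 : ℝ) n).card ≤ n + 1 := by
  have hsub : (F.filter fun k : ℤ => y - k ∈ Icc (0 : ℝ) n) ⊆ Finset.Icc (⌊y⌋ - n) ⌊y⌋ := by
    intro k hk
    obtain ⟨_, h0, h1⟩ := Finset.mem_filter.1 hk
    rw [Finset.mem_Icc]
    have h2 : k ≤ ⌊y⌋ := Int.le_floor.2 (by linarith)
    have h3 : ⌊y⌋ ≤ n + k := by
      have : (⌊y⌋ : ℝ) ≤ n + k := (Int.floor_le y).trans (by linarith)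
      exact_mod_cast this
    exact ⟨by omega, h2⟩
  refine (Finset.card_le_card hsub).trans ?_
  rw [Int.card_Icc]
  omega

theorem L2R.integrable_norm_sq (f : L2R) : Integrable fun x => ‖f x‖ ^ 2 :=
  (Lp.memLp f).integrable_norm_pow two_ne_zero

/-- The dyadic translates of a function supported in `[0, n]` overlap at most `n + 1` times. -/
theorem norm_sum_dyadic_sq_le {w : L2R} {n : ℕ} (hw : w ∈ supportedIn (Icc 0 n)) (j : ℕ)
    (F : Finset ℤ) (α : ℤ → ℂ) :
    ‖∑ k ∈ F, α k • dyadic w j k‖ ^ 2 ≤ (n + 1) * (∑ k ∈ F, ‖α k‖ ^ 2) * ‖w‖ ^ 2 := by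
  have hpt : ∀ᵐ x, ‖(∑ k ∈ F, α k • dyadic w j k : L2R) x‖ ^ 2
      ≤ (n + 1) * ∑ k ∈ F, ‖α k‖ ^ 2 * ‖dyadic w j k x‖ ^ 2 := by
    have h1 : ∀ᵐ x, ∀ k : ℤ, 2 ^ j * x - (k : ℝ) ∉ Icc (0 : ℝ) n → dyadic w j k x = 0 :=
      ae_all_iff.2 fun k => dyadic_mem_supportedIn (t := {x | 2 ^ j * x - (k : ℝ) ∈ Icc (0 : ℝ) n})
        hw (by simp)
    have h2 : ∀ᵐ x, ∀ k : ℤ, (α k • dyadic w j k : L2R) x = α k * dyadic w j k x :=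
      ae_all_iff.2 fun k => (Lp.coeFn_smul (α k) (dyadic w j k)).mono fun x hx => by
        rw [hx, Pi.smul_apply, smul_eq_mul]
    have h3 : ∀ᵐ x, (∑ k ∈ F, α k • dyadic w j k : L2R) x
        = ∑ k ∈ F, (α k • dyadic w j k : L2R) x := by
      filter_upwards [Lp.coeFn_finsetSum F fun k => α k • dyadic w j k] with x hx
      rw [hx, Finset.sum_apply]
    filter_upwards [h1, h2, h3] with x h1 h2 h3
    rw [h3]
    set G := F.filter fun k : ℤ => 2 ^ j * x - (k : ℝ) ∈ Icc (0 : ℝ) n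
    have h4 : ∑ k ∈ F, (α k • dyadic w j k : L2R) x = ∑ k ∈ G, α k * dyadic w j k x := by
      rw [Finset.sum_filter]
      refine Finset.sum_congr rfl fun k _ => ?_
      rw [h2]
      split_ifs with hk
      · rfl
      · rw [h1 k hk, mul_zero]
    rw [h4]
    -- Cauchy–Schwarz over the at most n + 1 translates that do not vanish at x.
    calc ‖∑ k ∈ G, α k * dyadic w j k x‖ ^ 2
        ≤ (∑ k ∈ G, ‖α k * dyadic w j k x‖) ^ 2 := by gcongr; exact norm_sum_le _ _
      _ ≤ G.card * ∑ k ∈ G, ‖α k * dyadic w j k x‖ ^ 2 := sq_sum_le_card_mul_sum_sq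
      _ ≤ (n + 1) * ∑ k ∈ F, ‖α k‖ ^ 2 * ‖dyadic w j k x‖ ^ 2 := by
        gcongr ?_ * ?_
        · exact (Nat.cast_le.2 (card_filter_translates_le F (2 ^ j * x) n)).trans_eq (by push_cast; rfl)
        · simp only [norm_mul, mul_pow]
          exact Finset.sum_le_sum_of_subset_of_nonneg (Finset.filter_subset _ _)
            fun k _ _ => by positivity
  rw [L2R.norm_sq_eq_integral]
  have hint : ∀ k ∈ F, Integrable fun x => ‖α k‖ ^ 2 * ‖dyadic w j k x‖ ^ 2 := fun k _ =>
    (L2R.integrable_norm_sq _).const_mul _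
  refine (integral_mono_ae (L2R.integrable_norm_sq _)
    ((integrable_finsetSum F hint).const_mul _) hpt).trans_eq ?_
  rw [integral_const_mul, integral_finsetSum F hint, mul_assoc, Finset.sum_mul]
  congr 1
  refine Finset.sum_congr rfl fun k _ => ?_
  rw [integral_const_mul, ← L2R.norm_sq_eq_integral, norm_dyadic]

/-! ### Decay of sampling coefficients by integration by parts -/

theorem inner_sampleVec_of_indicator {T₁ T₂ ε A B : ℝ} (hAB : A ≤ B)
    (hI : Icc A B ⊆ sampleInterval T₁ T₂ ε) (l : ℤ) {h : L2R} {G : ℝ → ℂ}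
    (hG : h =ᵐ[volume] (Icc A B).indicator G) :
    inner ℂ (sampleVec T₁ T₂ ε l) h = (Real.sqrt ε : ℂ) *
      ∫ x in A..B, G x * Complex.exp (-(2 * Real.pi * Complex.I * l * ε) * x) := by
  rw [inner_sampleVec, intervalIntegral.integral_of_le hAB, ← integral_Icc_eq_integral_Ioc,
    ← integral_const_mul, ← integral_indicator measurableSet_Icc,
    ← integral_indicator measurableSet_Icc]
  apply integral_congr_ae
  filter_upwards [hG] with x hx
  by_cases hxA : x ∈ Icc A B
  · rw [indicator_of_mem (hI hxA), indicator_of_mem hxA, hx, indicator_of_mem hxA, neg_mul]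
    ring
  · rw [indicator_of_notMem hxA]
    by_cases hxI : x ∈ Icc (-T₁ / (ε * (T₁ + T₂))) (T₂ / (ε * (T₁ + T₂)))
    · rw [indicator_of_mem hxI, hx, indicator_of_notMem hxA, mul_zero]
    · rw [indicator_of_notMem hxI]

/-- Integration by parts: the sampling coefficients of a function vanishing at the ends of its
support are dominated by those of its derivative, divided by the frequency. -/
theorem norm_inner_sampleVec_le_deriv {T₁ T₂ ε A B : ℝ} (hε : 0 < ε) (hAB : A ≤ B)
    (hI : Icc A B ⊆ sampleInterval T₁ T₂ ε) {h h' : L2R} {G G' : ℝ → ℂ}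
    (hG : ∀ x, HasDerivAt G (G' x) x) (hG' : Continuous G') (hA : G A = 0) (hB : G B = 0)
    (hh : h =ᵐ[volume] (Icc A B).indicator G) (hh' : h' =ᵐ[volume] (Icc A B).indicator G')
    (l : ℤ) :
    |(l : ℝ)| * ε * ‖inner ℂ (sampleVec T₁ T₂ ε l) h‖ ≤ ‖inner ℂ (sampleVec T₁ T₂ ε l) h'‖ := by
  set c : ℂ := -(2 * Real.pi * Complex.I * l * ε) with hc
  have hexp : ∀ x : ℝ, HasDerivAt (fun x : ℝ => Complex.exp (c * x)) (c * Complex.exp (c * x)) x := by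
    intro x
    have h1 : HasDerivAt (fun x : ℝ => c * (x : ℂ)) (c * 1) x :=
      (Complex.ofRealCLM.hasDerivAt (x := x)).const_mul c
    have := h1.cexp
    rwa [mul_one, mul_comm] at this
  have key := intervalIntegral.integral_mul_deriv_eq_deriv_mul (a := A) (b := B)
    (fun x _ => hG x) (fun x _ => hexp x) (hG'.intervalIntegrable _ _)
    ((by fun_prop : Continuous fun x : ℝ => c * Complex.exp (c * x)).intervalIntegrable _ _)
  rw [hA, hB, zero_mul, zero_mul, sub_zero, zero_sub] at key
  have hcomm : ∫ x in A..B, G x * (c * Complex.exp (c * x))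
      = c * ∫ x in A..B, G x * Complex.exp (c * x) := by
    rw [← intervalIntegral.integral_const_mul]
    congr 1
    funext x
    ring
  rw [hcomm] at key
  have hnorm : ‖c‖ * ‖∫ x in A..B, G x * Complex.exp (c * x)‖
      = ‖∫ x in A..B, G' x * Complex.exp (c * x)‖ := by
    rw [← norm_mul, key, norm_neg]
  -- In fact ‖c‖ = 2π|l|ε; the factor 2π is given away.
  have hcn : |(l : ℝ)| * ε ≤ ‖c‖ := by
    rw [hc, norm_neg]
    simp only [norm_mul, Complex.norm_ofNat, Complex.norm_real, Complex.norm_I,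
      Complex.norm_intCast, mul_one, Real.norm_of_nonneg Real.pi_pos.le, Real.norm_of_nonneg hε.le]
    have := mul_nonneg (abs_nonneg (l : ℝ)) hε.le
    nlinarith [Real.pi_gt_three]
  rw [inner_sampleVec_of_indicator hAB hI l hh, inner_sampleVec_of_indicator hAB hI l hh',
    norm_mul, norm_mul, ← hc, ← hnorm]
  calc |(l : ℝ)| * ε * (‖(Real.sqrt ε : ℂ)‖ * ‖∫ x in A..B, G x * Complex.exp (c * x)‖)
      ≤ ‖c‖ * (‖(Real.sqrt ε : ℂ)‖ * ‖∫ x in A..B, G x * Complex.exp (c * x)‖) := by gcongr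
    _ = _ := by ring

/-! ### Smooth approximation vanishing at the integers -/

theorem isOpen_Ioo_diff_int (n : ℕ) :
    IsOpen (Ioo (0 : ℝ) n ∩ (range ((↑) : ℤ → ℝ))ᶜ) :=
  isOpen_Ioo.inter Int.isClosedEmbedding_coe_real.isClosed_range.isOpen_compl

/-- Functions supported in `[0, n]` are `L²`-limits of continuously differentiable functions with
support in `[0, n]` that vanish at the integers. -/
theorem exists_smooth_approx {f : L2R} {n : ℕ} (hf : f ∈ supportedIn (Icc 0 n)) {δ : ℝ}
    (hδ : 0 < δ) :
    ∃ (g g' : ℝ → ℂ) (w w' : L2R), (∀ x, HasDerivAt g (g' x) x) ∧ Continuous g' ∧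
      (∀ m : ℤ, g m = 0) ∧ w =ᵐ[volume] g ∧ w' =ᵐ[volume] g' ∧
      w ∈ supportedIn (Icc 0 n) ∧ w' ∈ supportedIn (Icc 0 n) ∧ ‖f - w‖ < δ := by
  -- Removing the integers costs only a null set, and functions that vanish off U are zero at every
  -- integer.
  set U : Set ℝ := Ioo (0 : ℝ) n ∩ (range ((↑) : ℤ → ℝ))ᶜ with hU
  have hUo : IsOpen U := isOpen_Ioo_diff_int n
  let K : Submodule ℂ L2R :=
    { carrier := {w | ∃ g : ℝ → ℂ, ContDiff ℝ 1 g ∧ HasCompactSupport g ∧ (∀ x ∉ U, g x = 0) ∧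
        w =ᵐ[volume] g}
      zero_mem' := ⟨0, contDiff_const, HasCompactSupport.zero, fun _ _ => rfl, Lp.coeFn_zero _ _ _⟩
      add_mem' := by
        rintro v w ⟨g, h1, h2, h3, h4⟩ ⟨g', h1', h2', h3', h4'⟩
        refine ⟨g + g', h1.add h1', h2.add h2', fun x hx => ?_, (Lp.coeFn_add v w).trans
          (h4.add h4')⟩
        rw [Pi.add_apply, h3 x hx, h3' x hx, add_zero]
      smul_mem' := by
        rintro c w ⟨g, h1, h2, h3, h4⟩
        refine ⟨c • g, contDiff_const.smul h1, h2.smul_left (f := fun _ => c), fun x hx => ?_,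
          (Lp.coeFn_smul c w).trans (h4.const_smul c)⟩
        rw [Pi.smul_apply, h3 x hx, smul_zero] }
  have hmemLp : ∀ g : ℝ → ℂ, Continuous g → HasCompactSupport g → MemLp g 2 volume :=
    fun g h1 h2 => h1.memLp_of_hasCompactSupport h2
  have hfK : f ∈ K.topologicalClosure := by
    have : CompleteSpace K.topologicalClosure :=
      K.isClosed_topologicalClosure.completeSpace_coe
    -- The residual v is orthogonal to all test functions on U, hence zero a.e. on U, while f is
    -- zero a.e. off U. So v ⊥ f, which forces v = 0.
    set v := f - K.topologicalClosure.starProjection f with hv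
    have hvo : v ∈ K.topologicalClosureᗮ := Submodule.sub_starProjection_mem_orthogonal f
    have hvU : ∀ᵐ x, x ∈ U → v x = 0 := by
      refine hUo.ae_eq_zero_of_integral_contDiff_smul_eq_zero
        (((Lp.memLp v).locallyIntegrable one_le_two).locallyIntegrableOn _) fun g h1 h2 h3 => ?_
      have hg1 : ContDiff ℝ 1 fun x => (g x : ℂ) :=
        Complex.ofRealCLM.contDiff.comp (h1.of_le (by exact_mod_cast le_top))
      have hg2 : HasCompactSupport fun x => (g x : ℂ) :=
        h2.comp_left (g := ((↑) : ℝ → ℂ)) Complex.ofReal_zero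
      have hL := hmemLp _ hg1.continuous hg2
      have hgK : hL.toLp _ ∈ K := ⟨_, hg1, hg2, fun x hx => by
        rw [image_eq_zero_of_notMem_tsupport fun h => hx (h3 h), Complex.ofReal_zero],
        hL.coeFn_toLp⟩
      have h0 := hvo _ (K.le_topologicalClosure hgK)
      rw [L2.inner_def] at h0
      rw [← h0]
      apply integral_congr_ae
      filter_upwards [hL.coeFn_toLp] with x hx
      rw [hx, RCLike.inner_apply, Complex.conj_ofReal, Complex.real_smul, mul_comm]
    have hfU : ∀ᵐ x, x ∉ U → f x = 0 := by
      have hnull : volume (insert (0 : ℝ) (insert (n : ℝ) (range ((↑) : ℤ → ℝ)))) = 0 :=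
        (((countable_range _).insert _).insert _).measure_zero _
      filter_upwards [mem_supportedIn.1 hf, compl_mem_ae_iff.2 hnull] with x hx hx' hxU
      refine hx fun hI => hxU ?_
      simp only [mem_compl_iff, mem_insert_iff, not_or] at hx'
      exact ⟨⟨lt_of_le_of_ne hI.1 (Ne.symm hx'.1), lt_of_le_of_ne hI.2 hx'.2.1⟩, hx'.2.2⟩
    have hvf : inner ℂ v f = 0 := by
      rw [L2.inner_def]
      apply integral_eq_zero_of_ae
      filter_upwards [hvU, hfU] with x h1 h2
      by_cases hx : x ∈ U
      · rw [h1 hx, inner_zero_left]; rfl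
      · rw [h2 hx, inner_zero_right]; rfl
    have hvv : inner ℂ v v = 0 := by
      nth_rw 2 [hv]
      rw [inner_sub_right, hvf, Submodule.inner_left_of_mem_orthogonal
        (Submodule.starProjection_apply_mem _ f) hvo, sub_zero]
    rw [inner_self_eq_zero, hv, sub_eq_zero] at hvv
    rw [hvv]
    exact Submodule.starProjection_apply_mem _ f
  obtain ⟨w, ⟨g, h1, h2, h3, h4⟩, hw⟩ := Metric.mem_closure_iff.1 hfK δ hδ
  have hd' : Continuous (deriv g) := h1.continuous_deriv le_rfl
  have hL' := hmemLp _ hd' h2.deriv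
  have hts : tsupport g ⊆ Icc 0 n := closure_minimal (fun x hx => by
    by_contra hx'
    exact hx (h3 x fun hU' => hx' ⟨hU'.1.1.le, hU'.1.2.le⟩)) isClosed_Icc
  refine ⟨g, deriv g, w, hL'.toLp _, fun x => (h1.differentiable one_ne_zero x).hasDerivAt, hd',
    fun m => h3 _ fun h => h.2 ⟨m, rfl⟩, h4, hL'.coeFn_toLp, ?_, ?_, by rwa [← dist_eq_norm]⟩
  · filter_upwards [h4] with x hx hxI
    rw [hx, image_eq_zero_of_notMem_tsupport fun h => hxI (hts h)]
  · filter_upwards [hL'.coeFn_toLp] with x hx hxI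
    rw [hx, image_eq_zero_of_notMem_tsupport fun h => hxI (hts (tsupport_deriv_subset h))]

/-! ### Cutoffs and sums of dyadic translates -/

/-- The restriction of an element of `L²(ℝ)` to the interval `[A, B]`, extended by zero. -/
noncomputable def cutoff (A B : ℝ) (u : L2R) : L2R :=
  ((Lp.memLp u).indicator (measurableSet_Icc (a := A) (b := B))).toLp _

theorem coeFn_cutoff (A B : ℝ) (u : L2R) : cutoff A B u =ᵐ[volume] (Icc A B).indicator u :=
  MemLp.coeFn_toLp _

theorem cutoff_mem_supportedIn (A B : ℝ) (u : L2R) : cutoff A B u ∈ supportedIn (Icc A B) := by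
  filter_upwards [coeFn_cutoff A B u] with x hx hI
  rw [hx, indicator_of_notMem hI]

theorem coeFn_cutoff_of_ae_eq (A B : ℝ) {u : L2R} {G : ℝ → ℂ} (h : u =ᵐ[volume] G) :
    cutoff A B u =ᵐ[volume] (Icc A B).indicator G := by
  filter_upwards [coeFn_cutoff A B u, h] with x h1 h2
  rw [h1]
  by_cases hx : x ∈ Icc A B
  · rw [indicator_of_mem hx, indicator_of_mem hx, h2]
  · rw [indicator_of_notMem hx, indicator_of_notMem hx]

theorem norm_sub_cutoff_le {A B : ℝ} {f : L2R} (hf : f ∈ supportedIn (Icc A B)) (u : L2R) :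
    ‖f - cutoff A B u‖ ≤ ‖f - u‖ := by
  refine Lp.norm_le_norm_of_ae_le ?_
  filter_upwards [mem_supportedIn.1 hf, coeFn_cutoff A B u, Lp.coeFn_sub f (cutoff A B u),
    Lp.coeFn_sub f u] with x h1 h2 h3 h4
  rw [h3, h4, Pi.sub_apply, Pi.sub_apply, h2]
  by_cases hx : x ∈ Icc A B
  · rw [indicator_of_mem hx]
  · rw [indicator_of_notMem hx, h1 hx, sub_zero, norm_zero]
    exact norm_nonneg _

theorem norm_cutoff_le (A B : ℝ) (u : L2R) : ‖cutoff A B u‖ ≤ ‖u‖ := by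
  simpa using norm_sub_cutoff_le (A := A) (B := B) (Submodule.zero_mem _) u

theorem coeFn_sum_dyadic {w : L2R} {g : ℝ → ℂ} (hw : w =ᵐ[volume] g) (j : ℤ) (F : Finset ℤ)
    (α : ℤ → ℂ) :
    (∑ k ∈ F, α k • dyadic w j k : L2R) =ᵐ[volume] fun x =>
      ∑ k ∈ F, α k * ((((2 : ℝ) ^ ((j : ℝ) / 2) : ℝ) : ℂ) * g (2 ^ j * x - k)) := by
  have h2 : ∀ᵐ x, ∀ k : ℤ, (α k • dyadic w j k : L2R) x
      = α k * ((((2 : ℝ) ^ ((j : ℝ) / 2) : ℝ) : ℂ) * g (2 ^ j * x - k)) := by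
    refine ae_all_iff.2 fun k => ?_
    filter_upwards [Lp.coeFn_smul (α k) (dyadic w j k), coeFn_dyadic w j k,
      (quasiMeasurePreserving_affine (2 ^ j) (zpow_ne_zero j two_ne_zero) k).ae hw] with x h1 h2 h3
    rw [h1, Pi.smul_apply, smul_eq_mul, h2, h3]
  filter_upwards [Lp.coeFn_finsetSum F fun k => α k • dyadic w j k, h2] with x hx h2
  rw [hx, Finset.sum_apply]
  exact Finset.sum_congr rfl fun k _ => h2 k

/-- The overlap bound with √(n + 1) weakened to n + 1, which avoids roots in later constants. -/
theorem norm_sum_dyadic_le {w : L2R} {n : ℕ} (hw : w ∈ supportedIn (Icc 0 n)) (j : ℕ)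
    (F : Finset ℤ) (α : ℤ → ℂ) {C : ℝ} (hC : 0 ≤ C) (hα : ∑ k ∈ F, ‖α k‖ ^ 2 ≤ C ^ 2) :
    ‖∑ k ∈ F, α k • dyadic w j k‖ ≤ (n + 1) * C * ‖w‖ := by
  refine (pow_le_pow_iff_left₀ (norm_nonneg _) (by positivity) two_ne_zero).1 ?_
  refine (norm_sum_dyadic_sq_le hw j F α).trans ?_
  rw [mul_pow, mul_pow]
  gcongr
  have : (0 : ℝ) ≤ n := n.cast_nonneg
  nlinarith

/-! ### Uniform approximation of V_R by the sampling space -/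

/-- Since ε(T₁ + T₂) ≤ 1, the sampling interval contains [-T₁, T₂]. -/
theorem Icc_subset_sampleInterval {n : ℕ} (hn : 1 ≤ n) {T₁ T₂ ε : ℝ} (h₁ : (n : ℝ) - 1 ≤ T₁)
    (h₂ : 2 * (n : ℝ) - 1 ≤ T₂) (hε : 0 < ε) (hεT : ε ≤ 1 / (T₁ + T₂)) :
    Icc (-((n : ℝ) - 1)) (2 * n - 1) ⊆ sampleInterval T₁ T₂ ε := by
  have hn' : (1 : ℝ) ≤ n := by exact_mod_cast hn
  have hT : 0 < T₁ + T₂ := by linarith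
  rw [le_div_iff₀ hT] at hεT
  have hp : 0 < ε * (T₁ + T₂) := by positivity
  refine Icc_subset_Icc ?_ ?_
  · rw [div_le_iff₀ hp]
    nlinarith
  · rw [le_div_iff₀ hp]
    nlinarith

/-- Compactly supported elements of `V_R` are well approximated by the sampling space as soon as
its highest frequency exceeds a fixed multiple of `2^R`. -/
theorem IsMRA.exists_sampling_constant {V : ℤ → Submodule ℂ L2R} {φ : L2R} (hV : IsMRA V φ)
    {n : ℕ} (hn : 1 ≤ n) (hφ : φ ∈ supportedIn (Icc 0 n)) {η : ℝ} (hη : 0 < η) :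
    ∃ S : ℕ, 0 < S ∧ ∀ T₁ T₂ ε : ℝ, (n : ℝ) - 1 ≤ T₁ → 2 * (n : ℝ) - 1 ≤ T₂ →
      0 < ε → ε ≤ 1 / (T₁ + T₂) → ∀ (R M : ℕ) (f : L2R), f ∈ V R →
      f ∈ supportedIn (Icc (-((n : ℝ) - 1)) (2 * n - 1)) → (S : ℝ) * 2 ^ (R + 1) ≤ M * ε →
      ‖f - (sampleSpace T₁ T₂ ε M).starProjection f‖ ≤ η * ‖f‖ := by
  have hn' : (1 : ℝ) ≤ n := by exact_mod_cast hn
  obtain ⟨g, g', w, w', hg, hg', hgz, hwg, hwg', hw, hw', hδ⟩ :=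
    exists_smooth_approx hφ (show 0 < η / (2 * (n + 1)) by positivity)
  -- The tolerance η/(2(n + 1)) absorbs the overlap constant; S is chosen so that (n + 1)‖w'‖/S ≤
  -- η/2, and the + 1 keeps it positive.
  refine ⟨⌈2 * (n + 1) * ‖w'‖ / η⌉₊ + 1, Nat.succ_pos _, ?_⟩
  intro T₁ T₂ ε h₁ h₂ hε hεT R M f hfV hfJ hM
  set S : ℕ := ⌈2 * (n + 1) * ‖w'‖ / η⌉₊ + 1 with hS
  have hS1 : 2 * (n + 1) * ‖w'‖ ≤ S * η := by
    rw [← div_le_iff₀ hη, hS]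
    push_cast
    exact (Nat.le_ceil _).trans (by linarith)
  have hSpos : (0 : ℝ) < S := by rw [hS]; positivity
  have hT : 0 < T₁ + T₂ := by linarith
  have hI := Icc_subset_sampleInterval hn h₁ h₂ hε hεT
  have h2R : (1 : ℝ) ≤ 2 ^ R := one_le_pow₀ one_le_two
  set A : ℝ := -((n : ℝ) - 1) with hA
  set B : ℝ := 2 * n - 1 with hB
  have hAB : A ≤ B := by linarith
  -- A generous range containing every k for which φ_{R,k} can meet [A, B].
  set F : Finset ℤ := Finset.Icc (-(2 * n * 2 ^ R)) (2 * n * 2 ^ R) with hF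
  set α : ℤ → ℂ := fun k => inner ℂ (dyadic φ R k) f with hα
  have hsum : f = ∑ k ∈ F, α k • dyadic φ R k := by
    refine hV.eq_sum R hfV F fun k hk => ?_
    refine inner_eq_zero_of_supportedIn (dyadic_mem_supportedIn
      (t := {x | 2 ^ (R : ℤ) * x - (k : ℝ) ∈ Icc (0 : ℝ) n}) hφ fun x hx => hx) hfJ ?_
    rw [disjoint_left]
    rintro x ⟨hx0, hx1⟩ ⟨hxA, hxB⟩
    rw [zpow_natCast] at hx0 hx1
    refine hk (Finset.mem_Icc.2 ⟨?_, ?_⟩)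
    · have : (-(2 * n * 2 ^ R) : ℝ) ≤ k := by nlinarith
      exact_mod_cast this
    · have : (k : ℝ) ≤ 2 * n * 2 ^ R := by nlinarith
      exact_mod_cast this
  have hbessel : ∑ k ∈ F, ‖α k‖ ^ 2 ≤ ‖f‖ ^ 2 :=
    (orthonormal_dyadic hV.orthonormal R).sum_inner_products_le f
  set u : L2R := ∑ k ∈ F, α k • dyadic w R k with hu
  -- The derivative of u; the chain rule supplies the factor 2^R.
  set u' : L2R := ∑ k ∈ F, ((2 : ℂ) ^ R * α k) • dyadic w' R k with hu'
  have hfu : ‖f - u‖ ≤ η / 2 * ‖f‖ := by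
    have : f - u = ∑ k ∈ F, α k • dyadic (φ - w) R k := by
      rw [hu]
      nth_rw 1 [hsum]
      rw [← Finset.sum_sub_distrib]
      exact Finset.sum_congr rfl fun k _ => by rw [dyadic_sub, smul_sub]
    rw [this]
    refine (norm_sum_dyadic_le (Submodule.sub_mem _ hφ hw) R F α (norm_nonneg f) hbessel).trans ?_
    calc (n + 1) * ‖f‖ * ‖φ - w‖ ≤ (n + 1) * ‖f‖ * (η / (2 * (n + 1))) := by gcongr
      _ = η / 2 * ‖f‖ := by field_simp
  have hu'n : ‖u'‖ ≤ (n + 1) * (2 ^ R * ‖f‖) * ‖w'‖ := by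
    refine norm_sum_dyadic_le hw' R F _ (by positivity) ?_
    simp only [norm_mul, mul_pow, norm_pow, Complex.norm_ofNat]
    rw [← Finset.mul_sum]
    gcongr
  set G : ℝ → ℂ := fun x =>
    ∑ k ∈ F, α k * ((((2 : ℝ) ^ (((R : ℤ) : ℝ) / 2) : ℝ) : ℂ) * g (2 ^ (R : ℤ) * x - k)) with hG
  set G' : ℝ → ℂ := fun x => ∑ k ∈ F, ((2 : ℂ) ^ R * α k) *
    ((((2 : ℝ) ^ (((R : ℤ) : ℝ) / 2) : ℝ) : ℂ) * g' (2 ^ (R : ℤ) * x - k)) with hGp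
  have hGd : ∀ x, HasDerivAt G (G' x) x := by
    intro x
    refine HasDerivAt.fun_sum fun k _ => ?_
    have h1 : HasDerivAt (fun x : ℝ => (2 : ℝ) ^ (R : ℤ) * x - k) ((2 : ℝ) ^ (R : ℤ)) x := by
      simpa using ((hasDerivAt_id x).const_mul ((2 : ℝ) ^ (R : ℤ))).sub_const (k : ℝ)
    have h2 := (((hg _).scomp x h1).const_mul
      ((((2 : ℝ) ^ (((R : ℤ) : ℝ) / 2) : ℝ) : ℂ))).const_mul (α k)
    refine h2.congr_deriv ?_
    rw [Complex.real_smul]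
    push_cast
    simp only [zpow_natCast]
    ring
  have hGc : Continuous G' := by fun_prop
  -- 2^R m - k is an integer, and g vanishes there. As A and B are integers, cutting off at them
  -- leaves no boundary terms.
  have hGint : ∀ m : ℤ, G m = 0 := by
    intro m
    refine Finset.sum_eq_zero fun k _ => ?_
    have := hgz (2 ^ R * m - k)
    push_cast at this
    rw [zpow_natCast, this, mul_zero, mul_zero]
  have hGA : G A = 0 := by
    have := hGint (-((n : ℤ) - 1))
    push_cast at this
    exact this
  have hGB : G B = 0 := by
    have := hGint (2 * n - 1)
    push_cast at this
    exact this
  have happrox := norm_sub_starProjection_sampleSpace_le hT hε (cutoff A B u) (cutoff A B u')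
    (supportedIn_mono hI (cutoff_mem_supportedIn A B u))
    (supportedIn_mono hI (cutoff_mem_supportedIn A B u'))
    (norm_inner_sampleVec_le_deriv hε hAB hI hGd hGc hGA hGB
      (coeFn_cutoff_of_ae_eq A B (coeFn_sum_dyadic hwg R F α))
      (coeFn_cutoff_of_ae_eq A B (coeFn_sum_dyadic hwg' R F _)))
    (M := M) (K := S * 2 ^ R) (by positivity) (by rw [pow_succ] at hM; linarith)
  set P := sampleSpace T₁ T₂ ε M
  have hmin : ‖f - P.starProjection f‖ ≤ ‖f - P.starProjection (cutoff A B u)‖ := by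
    rw [Submodule.starProjection_minimal]
    exact ciInf_le ⟨0, by rintro _ ⟨y, rfl⟩; exact norm_nonneg _⟩
      (⟨_, Submodule.starProjection_apply_mem P (cutoff A B u)⟩ : P)
  have htail : ‖cutoff A B u'‖ / (S * 2 ^ R) ≤ η / 2 * ‖f‖ := by
    rw [div_le_iff₀ (by positivity)]
    calc ‖cutoff A B u'‖ ≤ (n + 1) * (2 ^ R * ‖f‖) * ‖w'‖ := (norm_cutoff_le A B u').trans hu'n
      _ = (2 * (n + 1) * ‖w'‖) * (2 ^ R * ‖f‖ / 2) := by ring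
      _ ≤ (S * η) * (2 ^ R * ‖f‖ / 2) := by gcongr
      _ = η / 2 * ‖f‖ * (S * 2 ^ R) := by ring
  calc ‖f - P.starProjection f‖ ≤ ‖f - P.starProjection (cutoff A B u)‖ := hmin
    _ = ‖(f - cutoff A B u) + (cutoff A B u - P.starProjection (cutoff A B u))‖ := by
      rw [sub_add_sub_cancel]
    _ ≤ ‖f - cutoff A B u‖ + ‖cutoff A B u - P.starProjection (cutoff A B u)‖ := norm_add_le _ _
    _ ≤ η / 2 * ‖f‖ + η / 2 * ‖f‖ :=
      add_le_add ((norm_sub_cutoff_le hfJ u).trans hfu) (happrox.trans htail)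
    _ = η * ‖f‖ := by ring

/-! ### Location of the reconstruction vectors -/

theorem levelDim_strictMono {n : ℕ} (hn : 1 ≤ n) : StrictMono (levelDim n) := by
  refine strictMono_nat_of_lt_succ fun R => ?_
  have : 0 < 2 ^ R * n := by positivity
  unfold levelDim
  rw [pow_succ]
  nlinarith [Nat.zero_le (n - 1)]

theorem two_pow_le_levelDim {n : ℕ} (hn : 1 ≤ n) (R : ℕ) : 2 ^ R ≤ levelDim n R := by
  unfold levelDim
  nlinarith [Nat.zero_le ((R + 1) * (n - 1)), Nat.one_le_two_pow (n := R)]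

theorem levelDim_scaleOf_le {n m : ℕ} (h : levelDim n 0 ≤ m) : levelDim n (scaleOf n m) ≤ m :=
  Nat.findGreatest_spec (P := fun j => levelDim n j ≤ m) (Nat.zero_le m) h

/-- The search bound m in `scaleOf` loses nothing, because j < 2^j ≤ N_j. -/
theorem lt_levelDim_scaleOf_succ {n m : ℕ} (hn : 1 ≤ n) : m < levelDim n (scaleOf n m + 1) := by
  by_contra! h
  have h1 : scaleOf n m + 1 ≤ m :=
    (Nat.lt_two_pow_self.le.trans (two_pow_le_levelDim hn _)).trans h
  exact Nat.findGreatest_is_greatest (P := fun j => levelDim n j ≤ m) (Nat.lt_succ_self _) h1 h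

theorem dyadic_mem_supportedIn_reconInterval {f : L2R} {n : ℕ} (hn : 1 ≤ n)
    (hf : f ∈ supportedIn (Icc 0 n)) {j : ℕ} {k : ℤ} (h₀ : -(n : ℤ) + 1 ≤ k)
    (h₁ : k ≤ 2 ^ j * n - 1) :
    dyadic f j k ∈ supportedIn (Icc (-((n : ℝ) - 1)) (2 * n - 1)) := by
  refine dyadic_mem_supportedIn hf ?_
  rintro x ⟨hx0, hx1⟩
  rw [zpow_natCast] at hx0 hx1
  have hn' : (1 : ℝ) ≤ n := by exact_mod_cast hn
  have hj : (1 : ℝ) ≤ 2 ^ j := one_le_pow₀ one_le_two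
  have h₀' : -(n : ℝ) + 1 ≤ k := by exact_mod_cast h₀
  have h₁' : (k : ℝ) ≤ 2 ^ j * n - 1 := by exact_mod_cast h₁
  -- This is exactly (2^j n - 1 + n)/2^j ≤ 2n - 1, the right end of the last translate.
  have hprod : 0 ≤ ((2 : ℝ) ^ j - 1) * (n - 1) := mul_nonneg (by linarith) (by linarith)
  have hpos : (0 : ℝ) < 2 ^ j := by positivity
  constructor
  · refine le_of_mul_le_mul_left ?_ hpos
    nlinarith
  · refine le_of_mul_le_mul_left ?_ hpos
    nlinarith

/-- A wavelet of scale j lies in V_{j+1}, and a number m < N_R forces j < R. -/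
theorem reconSpace_le {V : ℤ → Submodule ℂ L2R} {φ ψ : L2R} (hV : IsMRA V φ)
    (hW : IsMRAWavelet V ψ) {n : ℕ} (hn : 1 ≤ n) (hφ : φ ∈ supportedIn (Icc 0 n))
    (hψ : ψ ∈ supportedIn (Icc 0 n)) {N R : ℕ} (hN : N ≤ levelDim n R) :
    reconSpace φ ψ n N ≤ V R ⊓ supportedIn (Icc (-((n : ℝ) - 1)) (2 * n - 1)) := by
  refine Submodule.span_le.2 ?_
  rintro _ ⟨m, hm, rfl⟩
  have hmR : m < levelDim n R := lt_of_lt_of_le hm hN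
  unfold reconVec
  split_ifs with h0
  · have h0' : m < 2 * n - 1 := by
      simp only [levelDim, pow_zero, one_mul, zero_add] at h0
      omega
    refine ⟨?_, ?_⟩
    · exact hV.le_of_le (Int.natCast_nonneg R) (hV.scaling_mem _)
    · exact dyadic_mem_supportedIn_reconInterval (j := 0) hn hφ (by omega)
        (by rw [pow_zero, one_mul]; omega)
  · have h1 := levelDim_scaleOf_le (not_lt.1 h0)
    have h2 := lt_levelDim_scaleOf_succ (n := n) (m := m) hn
    set j := scaleOf n m
    have hjR : j < R := (levelDim_strictMono hn).lt_iff_lt.1 (h1.trans_lt hmR)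
    refine ⟨?_, ?_⟩
    · exact hV.le_of_le (by omega) (hV.dyadic_mem (hW.dyadic_zero_mem _) j)
    · refine dyadic_mem_supportedIn_reconInterval hn hψ (by omega) ?_
      -- The increment counts the wavelets of scale j, so the last one has k = 2^j n - 1.
      have h3 : levelDim n (j + 1) = levelDim n j + 2 ^ j * n + (n - 1) := by
        unfold levelDim
        rw [pow_succ]
        ring
      have h4 : (m : ℤ) < levelDim n j + 2 ^ j * n + (n - 1) := by
        have : (m : ℤ) < ((levelDim n j + 2 ^ j * n + (n - 1) : ℕ) : ℤ) := by
          rw [← h3]; exact_mod_cast h2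
        push_cast [hn] at this
        exact this
      omega

/-! ### Subspace angle and stable sampling rate -/

/-- A uniform bound on the distance to the sampling space bounds the subspace angle below. -/
theorem sqrt_le_subspaceAngle {φ ψ : L2R} {n N M : ℕ} {T₁ T₂ ε η : ℝ} (hφ : ∀ k, ‖dyadic φ 0 k‖ = 1)
    (hn : 1 ≤ n) (hN : 1 ≤ N) (h : ∀ f ∈ reconSpace φ ψ n N,
      ‖f - (sampleSpace T₁ T₂ ε M).starProjection f‖ ≤ η * ‖f‖) :
    Real.sqrt (1 - η ^ 2) ≤ subspaceAngle φ ψ n T₁ T₂ ε N M := by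
  refine Real.sqrt_le_sqrt (le_csInf ?_ ?_)
  -- A unit vector must be exhibited, since the real infimum over the empty set is 0 by convention.
  · refine ⟨_, reconVec φ ψ n 0, ⟨Submodule.subset_span ⟨0, hN, rfl⟩, ?_⟩, rfl⟩
    have : 0 < levelDim n 0 := lt_of_lt_of_le (by positivity) (two_pow_le_levelDim hn 0)
    rw [reconVec, if_pos this]
    exact hφ _
  · rintro _ ⟨f, ⟨hf, hf1⟩, rfl⟩
    set P := sampleSpace T₁ T₂ ε M
    have h1 := h f hf
    rw [hf1, mul_one] at h1
    have h2 := Submodule.norm_sq_eq_add_norm_sq_starProjection f P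
    have h3 : Pᗮ.starProjection f = f - P.starProjection f := by
      rw [Submodule.starProjection_orthogonal]; rfl
    have h4 : (inner ℂ (P.starProjection f) f).re = ‖P.starProjection f‖ ^ 2 := by
      have h5 : inner ℂ (P.starProjection f) (f - P.starProjection f) = 0 :=
        Submodule.sub_starProjection_mem_orthogonal f _ (Submodule.starProjection_apply_mem P f)
      rw [inner_sub_right, sub_eq_zero] at h5
      rw [h5, inner_self_eq_norm_sq_to_K]
      norm_cast
    rw [h3, hf1] at h2
    change 1 - η ^ 2 ≤ (inner ℂ (P.starProjection f) f).re
    rw [h4]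
    have := pow_le_pow_left₀ (norm_nonneg _) h1 2
    linarith

/-- For the least admissible R = r + 1, minimality gives 2^r ≤ N_r < N. -/
theorem exists_level {n : ℕ} (hn : 1 ≤ n) {N : ℕ} (hN : 1 ≤ N) :
    ∃ R, N ≤ levelDim n R ∧ 2 ^ R ≤ 2 * N := by
  have hex : ∃ R, N ≤ levelDim n R :=
    ⟨N, Nat.lt_two_pow_self.le.trans (two_pow_le_levelDim hn N)⟩
  classical
  refine ⟨Nat.find hex, Nat.find_spec hex, ?_⟩
  rcases hR : Nat.find hex with _ | r
  · omega
  · have h1 : ¬ N ≤ levelDim n r := Nat.find_min hex (by omega)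
    have h2 := two_pow_le_levelDim hn r
    rw [pow_succ]
    omega

theorem theorem4p1 (a : ℝ) (ha : 1 ≤ a) (V : ℤ → Submodule ℂ L2R) (φ ψ : L2R)
    (hφ : IsMRA V φ) (hψ : IsMRAWavelet V ψ)
    (hφs : essSupport φ = Set.Icc 0 a) (hψs : essSupport ψ = Set.Icc 0 a)
    (θ : ℝ) (hθ : 1 < θ) :
    ∃ S : ℕ, 0 < S ∧
      ∀ T₁ T₂ ε : ℝ, (⌈a⌉₊ : ℝ) - 1 ≤ T₁ → 2 * (⌈a⌉₊ : ℝ) - 1 ≤ T₂ →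
        0 < ε → ε ≤ 1 / (T₁ + T₂) →
        (∀ R N : ℕ, 1 ≤ N → N ≤ levelDim ⌈a⌉₊ R →
          1 / θ ≤ subspaceAngle φ ψ ⌈a⌉₊ T₁ T₂ ε N ⌈(S : ℝ) * 2 ^ (R + 1) / ε⌉₊) ∧
        (∀ N : ℕ, 1 ≤ N →
          stableSamplingRate φ ψ ⌈a⌉₊ T₁ T₂ ε N θ
            ≤ ((⌈2 * (S : ℝ) * N / (ε * ⌈a⌉₊)⌉₊ : ℕ) : ℕ∞)) ∧
        (fun N : ℕ => ((stableSamplingRate φ ψ ⌈a⌉₊ T₁ T₂ ε N θ).toNat : ℝ))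
          =O[Filter.atTop] (fun N : ℕ => (N : ℝ)) := by
  have hn : 1 ≤ ⌈a⌉₊ := Nat.one_le_ceil_iff.2 (by linarith)
  have hsub : Icc 0 a ⊆ Icc 0 (⌈a⌉₊ : ℝ) := Icc_subset_Icc_right (Nat.le_ceil a)
  have hφ' := supportedIn_mono hsub (hφs ▸ mem_supportedIn_essSupport φ)
  have hψ' := supportedIn_mono hsub (hψs ▸ mem_supportedIn_essSupport ψ)
  generalize ⌈a⌉₊ = n at hn hφ' hψ' ⊢
  have hn' : (1 : ℝ) ≤ n := by exact_mod_cast hn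
  have hθ0 : 0 < θ := by linarith
  have hθ1 : (1 / θ) ^ 2 < 1 :=
    pow_lt_one₀ (by positivity) ((div_lt_one hθ0).2 hθ) two_ne_zero
  -- With η² = (1 - θ⁻²)/2 one has 1 - η² > θ⁻²; the strict inequality is what Θ requires.
  obtain ⟨S, hS, hSmain⟩ := hφ.exists_sampling_constant hn hφ'
    (Real.sqrt_pos.2 (show 0 < (1 - (1 / θ) ^ 2) / 2 by linarith))
  have hangle : ∀ T₁ T₂ ε : ℝ, (n : ℝ) - 1 ≤ T₁ → 2 * (n : ℝ) - 1 ≤ T₂ →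
      0 < ε → ε ≤ 1 / (T₁ + T₂) → ∀ R N M : ℕ, 1 ≤ N → N ≤ levelDim n R →
      (S : ℝ) * 2 ^ (R + 1) ≤ M * ε → 1 / θ < subspaceAngle φ ψ n T₁ T₂ ε N M := by
    intro T₁ T₂ ε h₁ h₂ hε hεT R N M hN hNR hM
    refine lt_of_lt_of_le ?_ (sqrt_le_subspaceAngle
      (η := Real.sqrt ((1 - (1 / θ) ^ 2) / 2)) hφ.orthonormal.norm_eq_one hn hN fun f hf => ?_)
    · rw [Real.sq_sqrt (by linarith)]
      exact Real.lt_sqrt_of_sq_lt (by linarith)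
    · obtain ⟨hfV, hfJ⟩ := reconSpace_le hφ hψ hn hφ' hψ' hNR hf
      exact hSmain T₁ T₂ ε h₁ h₂ hε hεT R M f hfV hfJ hM
  have hnS : 0 < 2 * n * S := by positivity
  -- The factor n cancels the division by ⌈a⌉ in the rate, and the 2 pays for 2^R ≤ 2N.
  refine ⟨2 * n * S, hnS, fun T₁ T₂ ε h₁ h₂ hε hεT => ?_⟩
  have hrate : ∀ N : ℕ, 1 ≤ N → stableSamplingRate φ ψ n T₁ T₂ ε N θ
      ≤ ((⌈2 * ((2 * n * S : ℕ) : ℝ) * N / (ε * n)⌉₊ : ℕ) : ℕ∞) := by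
    intro N hN
    obtain ⟨R, hNR, hRN⟩ := exists_level hn hN
    have hRN' : (2 : ℝ) ^ R ≤ 2 * N := by exact_mod_cast hRN
    have hlt := hangle T₁ T₂ ε h₁ h₂ hε hεT R N ⌈2 * ((2 * n * S : ℕ) : ℝ) * N / (ε * n)⌉₊
      hN hNR (by
        rw [← div_le_iff₀ hε]
        refine le_trans ?_ (Nat.le_ceil _)
        push_cast
        rw [div_le_div_iff₀ hε (by positivity), pow_succ]
        calc (S : ℝ) * (2 ^ R * 2) * (ε * n) ≤ S * (2 * N * 2) * (ε * n) := by gcongr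
          _ = _ := by ring)
    have hpos := (one_div_pos.2 hθ0).trans hlt
    exact iInf₂_le _ ⟨hpos, (one_div_lt hθ0 hpos).1 hlt⟩
  refine ⟨fun R N hN hNR => (hangle T₁ T₂ ε h₁ h₂ hε hεT R N _ hN hNR ?_).le, hrate, ?_⟩
  · rw [← div_le_iff₀ hε]
    refine le_trans ?_ (Nat.le_ceil _)
    push_cast
    gcongr
    nlinarith
  -- The + 1 absorbs the rounding of the ceiling, as N ≥ 1. The rate is finite by `hrate`, so
  -- `toNat` does not hide a `⊤`.
  · refine Asymptotics.IsBigO.of_bound (2 * ((2 * n * S : ℕ) : ℝ) / (ε * n) + 1) ?_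
    filter_upwards [eventually_ge_atTop 1] with N hN
    rw [Real.norm_of_nonneg (Nat.cast_nonneg _), Real.norm_of_nonneg (Nat.cast_nonneg _)]
    have h1 : (stableSamplingRate φ ψ n T₁ T₂ ε N θ).toNat
        ≤ ⌈2 * ((2 * n * S : ℕ) : ℝ) * N / (ε * n)⌉₊ := ENat.toNat_le_of_le_natCast (hrate N hN)
    have h2 := Nat.ceil_lt_add_one
      (show 0 ≤ 2 * ((2 * n * S : ℕ) : ℝ) * N / (ε * n) by positivity)
    have hN' : (1 : ℝ) ≤ N := by exact_mod_cast hN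
    calc ((stableSamplingRate φ ψ n T₁ T₂ ε N θ).toNat : ℝ)
        ≤ ⌈2 * ((2 * n * S : ℕ) : ℝ) * N / (ε * n)⌉₊ := by exact_mod_cast h1
      _ ≤ 2 * ((2 * n * S : ℕ) : ℝ) * N / (ε * n) + N := by linarith
      _ = _ := by ring
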